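/- A \emph{tri-pointed metric space} is a metric space $(X,d)$ with $d\le 1$ together with three distinguished points $T_X,L_X,R_X$ at pairwise distance $1$. Let $\mathbf{Met_3}^{C}$ be the category whose objects are the tri-pointed metric spaces and whose morphisms are the continuous maps that preserve the three distinguished points. Let $M=\{a,b,c\}$. For an object $X$, give $M\times X$ the metric $d((m,x),(n,y))=\tfrac12 d(x,y)$ if $m=n$ and $1$ if $m\ne n$; let $M\otimes X$ be the quotient of $M\times X$ by the equivalence relation generated by $(b,T_X)\sim(a,L_X)$, $(a,R_X)\sim(c,T_X)$, $(c,L_X)\sim(b,R_X)$, with the quotient metric (the infimum of the lengths of chains), write $m\otimes x$ for the class of $(m,x)$, and take $a\otimes T_X$, $b\otimes L_X$, $c\otimes R_X$ as the distinguished points $T,L,R$ of $M\otimes X$. This gives an endofunctor $F=M\otimes -$ of $\mathbf{Met_3}^{C}$, with $F(f)(m\otimes x)=m\otimes f(x)$. Let $\sigma_a,\sigma_b,\sigma_c:\mathbb{R}^2\to\mathbb{R}^2$ be $$\sigma_a(x,y)=\left(\tfrac x2+\tfrac14,\tfrac y2+\tfrac{\sqrt3}4\right),\quad \sigma_b(x,y)=\left(\tfrac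 x2,\tfrac y2\right),\quad \sigma_c(x,y)=\left(\tfrac x2+\tfrac12,\tfrac y2\right),$$ and let $\mathbb{S}\subset\mathbb{R}^2$ be the Sierpinski gasket, the unique nonempty compact set with $\mathbb{S}=\sigma_a(\mathbb{S})\cup\sigma_b(\mathbb{S})\cup\sigma_c(\mathbb{S})$ (equivalently, the closure of the orbit of the fixed points of the $\sigma_m$ under the $\sigma_m$). With the Euclidean metric and the distinguished points $T=(\tfrac12,\tfrac{\sqrt3}2)$, $L=(0,0)$, $R=(1,0)$ it is an object of $\mathbf{Met_3}^{C}$. \textbf{Theorem.} The assignment $\tau(m\otimes x)=\sigma_m(x)$ is a well-defined isomorphism $\tau:M\otimes\mathbb{S}\to\mathbb{S}$ in $\mathbf{Met_3}^{C}$, and with $\sigma=\tau^{-1}:\mathbb{S}\to M\otimes\mathbb{S}$ the coalgebra $(\mathbb{S},\sigma)$ is the final $F$-coalgebra on $\mathbf{Met_3}^{C}$: for every object $X$ and every morphism $e:X\to M\otimes X$ there is exactly one morphism $f:X\to\mathbb{S}$ with $\sigma\circ f=(M\otimes f)\circ e$. -/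

import Mathlib

open CategoryTheory

universe u

/-- The three-element index set `M = {a, b, c}`. -/
inductive Label : Type
  | a | b | c
  deriving DecidableEq

/-- A tri-pointed metric space: a metric space bounded by one with three distinguished points
`T = pt a`, `L = pt b`, `R = pt c` at mutual distance one. -/
structure TriMet : Type (u + 1) where
  carrier : Type u
  [metric : MetricSpace carrier]
  pt : Label → carrier
  dist_le_one : ∀ x y : carrier, dist x y ≤ 1
  dist_pt : ∀ m n : Label, m ≠ n → dist (pt m) (pt n) = 1

namespace TriMet

attribute [instance] TriMet.metric

/-- The top distinguished point. -/
abbrev T (X : TriMet.{u}) : X.carrier := X.pt Label.a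

/-- The left distinguished point. -/
abbrev L (X : TriMet.{u}) : X.carrier := X.pt Label.b

/-- The right distinguished point. -/
abbrev R (X : TriMet.{u}) : X.carrier := X.pt Label.c

/-- Morphisms: continuous maps preserving the three distinguished points. -/
@[ext]
structure Hom (X Y : TriMet.{u}) where
  toFun : X.carrier → Y.carrier
  continuous_toFun : Continuous toFun
  map_pt : ∀ m, toFun (X.pt m) = Y.pt m

/-- The category of tri-pointed one-bounded metric spaces and continuous point-preserving maps. -/
instance : Category TriMet.{u} where
  Hom := Hom
  id X := ⟨id, continuous_id, fun _ => rfl⟩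
  comp f g := ⟨g.toFun ∘ f.toFun, g.continuous_toFun.comp f.continuous_toFun,
    fun m => by simp [f.map_pt, g.map_pt]⟩

variable (X : TriMet.{u})

/-- The metric on `M × X`. -/
noncomputable def prodDist (p q : Label × X.carrier) : ℝ :=
  if p.1 = q.1 then dist p.2 q.2 / 2 else 1

/-- The generating identifications on `M × X`. -/
inductive Glue : Label × X.carrier → Label × X.carrier → Prop
  | ba : Glue (Label.b, X.T) (Label.a, X.L)
  | ac : Glue (Label.a, X.R) (Label.c, X.T)
  | cb : Glue (Label.c, X.L) (Label.b, X.R)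

/-- The underlying set of `M ⊗ X`: the quotient of `M × X` by the equivalence relation generated
by `Glue`. -/
def Tensor : Type u := Quot X.Glue

/-- The class `m ⊗ x` of `(m, x)`. -/
def tmul (m : Label) (x : X.carrier) : X.Tensor := Quot.mk _ (m, x)

/-- `X.Chain p q r` says that there is a chain of total length `r` from `p` to `q` in `M ⊗ X`:
each step goes from the class of some `(m, x)` to the class of some `(n, y)` and costs
the distance of `(m, x)` and `(n, y)` in `M × X`. -/
inductive Chain (p : X.Tensor) : X.Tensor → ℝ → Prop
  | nil : Chain p p 0
  | step {m n : Label} {x y : X.carrier} {r : ℝ} :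
      Chain p (X.tmul m x) r → Chain p (X.tmul n y) (r + X.prodDist (m, x) (n, y))

/-- The quotient metric on `M ⊗ X`: the infimum of the lengths of chains. -/
noncomputable def tensorDist (p q : X.Tensor) : ℝ := sInf {r | X.Chain p q r}

variable {X}

theorem tmul_glue (m n : Label) : X.tmul m (X.pt n) = X.tmul n (X.pt m) := by
  cases m <;> cases n <;>
    first
      | rfl
      | exact Quot.sound Glue.ba
      | exact Quot.sound Glue.ac
      | exact Quot.sound Glue.cb
      | exact (Quot.sound Glue.ba).symm
      | exact (Quot.sound Glue.ac).symm
      | exact (Quot.sound Glue.cb).symm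

theorem tensor_cases (p : X.Tensor) : ∃ m x, p = X.tmul m x := by
  induction p using Quot.ind with
  | mk p => exact ⟨p.1, p.2, rfl⟩

theorem prodDist_nonneg (p q : Label × X.carrier) : 0 ≤ X.prodDist p q := by
  unfold prodDist; split_ifs <;> positivity

theorem prodDist_comm (p q : Label × X.carrier) : X.prodDist p q = X.prodDist q p := by
  unfold prodDist; simp only [eq_comm (a := p.1), dist_comm p.2]

theorem prodDist_le_one (p q : Label × X.carrier) : X.prodDist p q ≤ 1 := by
  unfold prodDist
  have := X.dist_le_one p.2 q.2
  split_ifs <;> linarith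

theorem Chain.nonneg {p q : X.Tensor} {r : ℝ} (h : X.Chain p q r) : 0 ≤ r := by
  induction h with
  | nil => exact le_rfl
  | step _ ih => exact add_nonneg ih (prodDist_nonneg _ _)

theorem Chain.single (m n : Label) (x y : X.carrier) :
    X.Chain (X.tmul m x) (X.tmul n y) (X.prodDist (m, x) (n, y)) := by
  simpa using Chain.step (X := X) (n := n) (y := y) (Chain.nil (p := X.tmul m x))

theorem Chain.trans {p q s : X.Tensor} {r t : ℝ} (h : X.Chain p q r) (h' : X.Chain q s t) :
    X.Chain p s (r + t) := by
  induction h' with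
  | nil => simpa using h
  | step _ ih => rw [← add_assoc]; exact Chain.step ih

theorem Chain.symm {p q : X.Tensor} {r : ℝ} (h : X.Chain p q r) : X.Chain q p r := by
  induction h with
  | nil => exact Chain.nil
  | step _ ih =>
    rw [add_comm, prodDist_comm]
    exact (Chain.single _ _ _ _).trans ih

theorem chain_bddBelow (p q : X.Tensor) : BddBelow {r | X.Chain p q r} :=
  ⟨0, fun _ h => Chain.nonneg h⟩

theorem chain_nonempty (p q : X.Tensor) : {r | X.Chain p q r}.Nonempty := by
  obtain ⟨m, x, rfl⟩ := tensor_cases p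
  obtain ⟨n, y, rfl⟩ := tensor_cases q
  exact ⟨_, Chain.single m n x y⟩

theorem tensorDist_le {p q : X.Tensor} {r : ℝ} (h : X.Chain p q r) : X.tensorDist p q ≤ r :=
  csInf_le (chain_bddBelow p q) h

theorem tensorDist_le_one (p q : X.Tensor) : X.tensorDist p q ≤ 1 := by
  obtain ⟨m, x, rfl⟩ := tensor_cases p
  obtain ⟨n, y, rfl⟩ := tensor_cases q
  exact (tensorDist_le (Chain.single m n x y)).trans (prodDist_le_one _ _)

theorem tensorDist_self (p : X.Tensor) : X.tensorDist p p = 0 :=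
  le_antisymm (tensorDist_le Chain.nil)
    (le_csInf (chain_nonempty p p) fun _ h => Chain.nonneg h)

theorem tensorDist_comm (p q : X.Tensor) : X.tensorDist p q = X.tensorDist q p := by
  unfold tensorDist
  congr 1
  ext r
  exact ⟨Chain.symm, Chain.symm⟩

theorem tensorDist_triangle (p q s : X.Tensor) :
    X.tensorDist p s ≤ X.tensorDist p q + X.tensorDist q s := by
  refine le_of_forall_pos_le_add fun ε hε => ?_
  obtain ⟨r, hr, hr'⟩ := exists_lt_of_csInf_lt (chain_nonempty p q)
    (lt_add_of_pos_right (X.tensorDist p q) (half_pos hε))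
  obtain ⟨t, ht, ht'⟩ := exists_lt_of_csInf_lt (chain_nonempty q s)
    (lt_add_of_pos_right (X.tensorDist q s) (half_pos hε))
  have := tensorDist_le (Chain.trans hr ht)
  linarith

/-- The label different from two given distinct ones. -/
def third : Label → Label → Label
  | .a, .b => .c
  | .b, .a => .c
  | .a, .c => .b
  | .c, .a => .b
  | .b, .c => .a
  | .c, .b => .a
  | m, _ => m

/-- The explicit formula for the quotient metric, on representatives. -/
noncomputable def formula (m : Label) (x : X.carrier) (n : Label) (y : X.carrier) : ℝ :=
  if m = n then dist x y / 2 else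
    min (dist x (X.pt n) + dist (X.pt m) y)
      (dist x (X.pt (third m n)) + 1 + dist (X.pt (third m n)) y) / 2

theorem formula_le_one (m : Label) (x : X.carrier) (n : Label) (y : X.carrier) :
    formula m x n y ≤ 1 := by
  unfold formula
  have h1 := X.dist_le_one x y
  have h2 := X.dist_le_one x (X.pt n)
  have h3 := X.dist_le_one (X.pt m) y
  split_ifs
  · linarith
  · have := min_le_left (dist x (X.pt n) + dist (X.pt m) y)
      (dist x (X.pt (third m n)) + 1 + dist (X.pt (third m n)) y)
    linarith

theorem formula_lipschitz (m : Label) (x : X.carrier) (n : Label) (y z : X.carrier) :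
    formula m x n z ≤ formula m x n y + dist y z / 2 := by
  unfold formula
  split_ifs
  · have := dist_triangle x y z
    linarith
  · have h1 := dist_triangle (X.pt m) y z
    have h2 := dist_triangle (X.pt (third m n)) y z
    rw [← add_div]
    gcongr
    rw [← min_add_add_right]
    exact min_le_min (by linarith) (by linarith)

theorem formula_glue (m : Label) (x : X.carrier) (n k : Label) :
    formula m x n (X.pt k) = formula m x k (X.pt n) := by
  have hab := X.dist_pt .a .b (by simp)
  have hac := X.dist_pt .a .c (by simp)
  have hba := X.dist_pt .b .a (by simp)
  have hbc := X.dist_pt .b .c (by simp)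
  have hca := X.dist_pt .c .a (by simp)
  have hcb := X.dist_pt .c .b (by simp)
  have t := fun i j => dist_triangle x (X.pt i) (X.pt j)
  have tab := t .a .b
  have tac := t .a .c
  have tba := t .b .a
  have tbc := t .b .c
  have tca := t .c .a
  have tcb := t .c .b
  clear t
  rw [hab] at tab
  rw [hac] at tac
  rw [hba] at tba
  rw [hbc] at tbc
  rw [hca] at tca
  rw [hcb] at tcb
  cases m <;> cases n <;> cases k <;>
    simp [formula, third, hab, hac, hba, hbc, hca, hcb] <;>
    first
      | linarith
      | (rw [min_comm])

/-- The formula with its second argument in the quotient. -/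
noncomputable def formulaQ (m : Label) (x : X.carrier) : X.Tensor → ℝ :=
  Quot.lift (fun p => formula m x p.1 p.2) (by
    rintro _ _ (_ | _ | _) <;> exact formula_glue _ _ _ _)

theorem formula_le_of_chain {m : Label} {x : X.carrier} {q : X.Tensor} {r : ℝ}
    (h : X.Chain (X.tmul m x) q r) : formulaQ m x q ≤ r := by
  induction h with
  | nil =>
    change formula m x m x ≤ 0
    simp [formula]
  | @step n k y z r hc ih =>
    change formula m x n y ≤ r at ih
    change formula m x k z ≤ _
    unfold prodDist
    by_cases hnk : n = k
    · subst hnk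
      have := formula_lipschitz m x n y z
      simp only [if_true]
      linarith
    · have := formula_le_one m x k z
      have := Chain.nonneg hc
      simp only [hnk, if_false]
      linarith

/-- The explicit formula for the quotient metric. -/
theorem tensorDist_tmul (m n : Label) (x y : X.carrier) :
    X.tensorDist (X.tmul m x) (X.tmul n y) = formula m x n y := by
  apply le_antisymm
  · unfold formula
    split_ifs with h
    · subst h
      refine (tensorDist_le (Chain.single m m x y)).trans ?_
      simp [prodDist]
    · have key : ∀ k (u v : X.carrier),
          X.tensorDist (X.tmul k u) (X.tmul k v) ≤ dist u v / 2 := fun k u v =>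
        (tensorDist_le (Chain.single k k u v)).trans (by simp [prodDist])
      rw [← min_div_div_right (by norm_num)]
      apply le_min
      · have h1 := key m x (X.pt n)
        have h2 := key n (X.pt m) y
        have h3 := tensorDist_triangle (X.tmul m x) (X.tmul m (X.pt n)) (X.tmul n y)
        rw [tmul_glue m n] at h1 h3
        linarith
      · set k := third m n with hk
        have h1 := key m x (X.pt k)
        have h2 := key k (X.pt m) (X.pt n)
        have h3 := key n (X.pt k) y
        have h4 := tensorDist_triangle (X.tmul m x) (X.tmul m (X.pt k)) (X.tmul n y)
        have h5 := tensorDist_triangle (X.tmul m (X.pt k)) (X.tmul n (X.pt k)) (X.tmul n y)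
        rw [tmul_glue k m, tmul_glue k n] at h2
        have := X.dist_le_one (X.pt m) (X.pt n)
        linarith
  · exact le_csInf (chain_nonempty _ _) fun r hr => formula_le_of_chain hr

theorem eq_of_tensorDist_eq_zero {p q : X.Tensor} (h : X.tensorDist p q = 0) : p = q := by
  obtain ⟨m, x, rfl⟩ := tensor_cases p
  obtain ⟨n, y, rfl⟩ := tensor_cases q
  rw [tensorDist_tmul] at h
  unfold formula at h
  split_ifs at h with hmn
  · subst hmn
    rw [dist_eq_zero.1 (show dist x y = 0 by linarith)]
  · have h1 : 0 ≤ dist x (X.pt n) := dist_nonneg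
    have h2 : 0 ≤ dist (X.pt m) y := dist_nonneg
    have h3 : 0 ≤ dist x (X.pt (third m n)) := dist_nonneg
    have h4 : 0 ≤ dist (X.pt (third m n)) y := dist_nonneg
    rcases min_choice (dist x (X.pt n) + dist (X.pt m) y)
      (dist x (X.pt (third m n)) + 1 + dist (X.pt (third m n)) y) with h' | h' <;> rw [h'] at h
    · rw [dist_eq_zero.1 (show dist x (X.pt n) = 0 by linarith),
        ← dist_eq_zero.1 (show dist (X.pt m) y = 0 by linarith)]
      exact tmul_glue m n
    · linarith

noncomputable instance : MetricSpace X.Tensor where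
  dist := X.tensorDist
  dist_self := tensorDist_self
  dist_comm := tensorDist_comm
  dist_triangle := tensorDist_triangle
  eq_of_dist_eq_zero := eq_of_tensorDist_eq_zero

theorem dist_tmul (m n : Label) (x y : X.carrier) :
    dist (X.tmul m x) (X.tmul n y) = formula m x n y := tensorDist_tmul m n x y

theorem dist_tmul_same (m : Label) (x y : X.carrier) :
    dist (X.tmul m x) (X.tmul m y) = dist x y / 2 := by
  simp [dist_tmul, formula]

variable (X) in
/-- The tri-pointed metric space `F X = M ⊗ X`, with distinguished points
`a ⊗ T`, `b ⊗ L` and `c ⊗ R`. -/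
noncomputable def tensor : TriMet.{u} where
  carrier := X.Tensor
  pt m := X.tmul m (X.pt m)
  dist_le_one := tensorDist_le_one
  dist_pt m n h := by
    rw [dist_tmul, formula, if_neg h, X.dist_pt m n h]
    have h1 : third m n ≠ m ∧ third m n ≠ n := by
      cases m <;> cases n <;> simp_all [third]
    rw [X.dist_pt _ _ h1.1.symm, X.dist_pt _ _ h1.2]
    norm_num

theorem continuous_tmul (m : Label) : Continuous (X.tmul m) := by
  refine LipschitzWith.continuous (K := 1) (LipschitzWith.of_dist_le_mul fun x y => ?_)
  rw [dist_tmul_same]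
  have : 0 ≤ dist x y := dist_nonneg
  simp only [NNReal.coe_one]
  linarith

variable {Y : TriMet.{u}}

/-- The map `m ⊗ x ↦ m ⊗ f x`. -/
def tensorMapFun (f : X ⟶ Y) : X.Tensor → Y.Tensor :=
  Quot.lift (fun p => Y.tmul p.1 (Hom.toFun f p.2)) (by
    rintro _ _ (_ | _ | _) <;> simp only [Hom.map_pt] <;> exact tmul_glue _ _)

theorem dist_le_of_dist_tmul {m n : Label} {x y : X.carrier} {ε : ℝ} (hmn : m ≠ n)
    (hε : ε ≤ 1 / 2) (h : dist (X.tmul m x) (X.tmul n y) < ε) :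
    dist x (X.pt n) + dist (X.pt m) y < 2 * ε := by
  rw [dist_tmul, formula, if_neg hmn] at h
  have h3 : 0 ≤ dist x (X.pt (third m n)) := dist_nonneg
  have h4 : 0 ≤ dist (X.pt (third m n)) y := dist_nonneg
  rcases min_choice (dist x (X.pt n) + dist (X.pt m) y)
      (dist x (X.pt (third m n)) + 1 + dist (X.pt (third m n)) y) with h' | h' <;>
    rw [h'] at h <;> linarith

theorem continuous_tensorMapFun (f : X ⟶ Y) : Continuous (tensorMapFun f) := by
  have hf := Hom.continuous_toFun f
  rw [Metric.continuous_iff]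
  intro p ε hε
  obtain ⟨n, y, rfl⟩ := tensor_cases p
  obtain ⟨δ, hδ, h⟩ := Metric.continuous_iff.1 hf y (ε / 2) (half_pos hε)
  have hp : ∀ m, ∃ δ > 0, ∀ x, dist x (X.pt m) < δ →
      dist (Hom.toFun f x) (Hom.toFun f (X.pt m)) < ε / 2 := fun m =>
    Metric.continuous_iff.1 hf (X.pt m) (ε / 2) (half_pos hε)
  obtain ⟨δ', hδ', h'⟩ := hp n
  refine ⟨min (min δ δ' / 2) (1 / 2), by positivity, fun q hq => ?_⟩
  obtain ⟨m, x, rfl⟩ := tensor_cases q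
  have hq1 := hq.trans_le (min_le_left _ _)
  have m1 := min_le_left δ δ'
  have m2 := min_le_right δ δ'
  change dist (Y.tmul m (Hom.toFun f x)) (Y.tmul n (Hom.toFun f y)) < ε
  by_cases hmn : m = n
  · subst hmn
    rw [dist_tmul_same] at hq1 ⊢
    have := h x (by linarith)
    have := dist_nonneg (x := Hom.toFun f x) (y := Hom.toFun f y)
    linarith
  · have key := dist_le_of_dist_tmul hmn (min_le_right _ _) hq
    have k1 := min_le_left (min δ δ' / 2) (1 / 2)
    have n1 : 0 ≤ dist x (X.pt n) := dist_nonneg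
    have n2 : 0 ≤ dist (X.pt m) y := dist_nonneg
    have a1 := h' x (by linarith)
    have a2 := h (X.pt m) (by linarith)
    rw [Hom.map_pt f] at a1 a2
    have t := dist_triangle (Y.tmul m (Hom.toFun f x)) (Y.tmul m (Y.pt n))
      (Y.tmul n (Hom.toFun f y))
    rw [dist_tmul_same, tmul_glue m n, dist_tmul_same] at t
    linarith

/-- The functor `F = M ⊗ -` on the category of tri-pointed metric spaces and continuous maps. -/
noncomputable def F : TriMet.{u} ⥤ TriMet.{u} where
  obj X := X.tensor
  map {X Y} f :=
    { toFun := tensorMapFun f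
      continuous_toFun := continuous_tensorMapFun f
      map_pt := fun m => congrArg (Y.tmul m) (Hom.map_pt f m) }
  map_id X := Hom.ext (funext fun p => by
    obtain ⟨m, x, rfl⟩ := tensor_cases p
    rfl)
  map_comp {X Y Z} f g := Hom.ext (funext fun p => by
    obtain ⟨m, x, rfl⟩ := tensor_cases p
    rfl)

end TriMet

namespace Sierpinski

/-- The three contractions of the plane. -/
noncomputable def ifs : Label → EuclideanSpace ℝ (Fin 2) → EuclideanSpace ℝ (Fin 2)
  | .a, x => !₂[x 0 / 2 + 1 / 4, x 1 / 2 + √3 / 4]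
  | .b, x => !₂[x 0 / 2, x 1 / 2]
  | .c, x => !₂[x 0 / 2 + 1 / 2, x 1 / 2]

/-- The fixed points of the three contractions. -/
noncomputable def corner : Label → EuclideanSpace ℝ (Fin 2)
  | .a => !₂[1 / 2, √3 / 2]
  | .b => !₂[0, 0]
  | .c => !₂[1, 0]

/-- The orbit of the three fixed points under the three contractions. -/
inductive Orbit : EuclideanSpace ℝ (Fin 2) → Prop
  | corner (m : Label) : Orbit (corner m)
  | step (m : Label) {x : EuclideanSpace ℝ (Fin 2)} : Orbit x → Orbit (ifs m x)

/-- The Sierpinski gasket, as the closure of the orbit of the three fixed points. It is the unique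
nonempty compact set invariant under the iterated function system, see `gasket_nonempty`,
`gasket_isCompact`, `gasket_eq_iUnion` and `eq_gasket`. -/
def gasket : Set (EuclideanSpace ℝ (Fin 2)) := closure {x | Orbit x}

theorem ifs_eq (m : Label) (x : EuclideanSpace ℝ (Fin 2)) :
    ifs m x = (1 / 2 : ℝ) • (x + corner m) := by
  ext i
  cases m <;> fin_cases i <;> simp [ifs, corner] <;> ring

theorem ifs_corner (m : Label) : ifs m (corner m) = corner m := by
  rw [ifs_eq, ← two_smul ℝ (corner m), smul_smul]
  norm_num

theorem dist_ifs (m : Label) (x y : EuclideanSpace ℝ (Fin 2)) :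
    dist (ifs m x) (ifs m y) = dist x y / 2 := by
  rw [ifs_eq, ifs_eq, dist_smul₀, dist_add_right]
  norm_num
  ring

theorem dist_ifs_le (m : Label) (x y : EuclideanSpace ℝ (Fin 2)) :
    dist (ifs m x) y ≤ (dist x y + dist (corner m) y) / 2 := by
  have h : ifs m x - y = (1 / 2 : ℝ) • ((x - y) + (corner m - y)) := by
    rw [ifs_eq]; module
  rw [dist_eq_norm, dist_eq_norm, dist_eq_norm, h, norm_smul]
  have := norm_add_le (x - y) (corner m - y)
  norm_num
  linarith

theorem dist_corner {m n : Label} (h : m ≠ n) : dist (corner m) (corner n) = 1 := by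
  have h3 : (√3 : ℝ) ^ 2 = 3 := Real.sq_sqrt (by norm_num)
  rw [EuclideanSpace.dist_eq, Real.sqrt_eq_one]
  cases m <;> cases n <;>
    simp [corner, Fin.sum_univ_two, Real.dist_eq, sq_abs] at h ⊢ <;>
    ring_nf <;> rw [h3] <;> norm_num

theorem dist_le_one_of_mem {x y : EuclideanSpace ℝ (Fin 2)} (hx : x ∈ gasket) (hy : y ∈ gasket) :
    dist x y ≤ 1 := by
  have hc : ∀ m n, dist (corner m) (corner n) ≤ 1 := fun m n => by
    by_cases h : m = n
    · simp [h]
    · exact (dist_corner h).le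
  have h1 : ∀ n x, Orbit x → dist x (corner n) ≤ 1 := fun n x hx => by
    induction hx with
    | corner m => exact hc m n
    | @step m x _ ih => linarith [dist_ifs_le m x (corner n), hc m n]
  have h2 : ∀ x y, Orbit x → Orbit y → dist x y ≤ 1 := fun x y hx hy => by
    induction hx with
    | corner m => rw [dist_comm]; exact h1 m y hy
    | @step m x _ ih =>
      have := h1 m y hy
      rw [dist_comm] at this
      linarith [dist_ifs_le m x y]
  have h3 : ∀ y, Orbit y → ∀ x ∈ gasket, x ∈ Metric.closedBall y 1 := fun y hy x hx =>
    closure_minimal (fun z hz => h2 z y hz hy) Metric.isClosed_closedBall hx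
  have h4 : y ∈ Metric.closedBall x 1 :=
    closure_minimal (fun z hz => by
      have := h3 z hz x hx
      rw [Metric.mem_closedBall] at this ⊢
      rwa [dist_comm]) Metric.isClosed_closedBall hy
  rw [dist_comm]
  exact h4

theorem corner_mem (m : Label) : corner m ∈ gasket := subset_closure (Orbit.corner m)

theorem gasket_nonempty : gasket.Nonempty := ⟨_, corner_mem Label.a⟩

theorem gasket_isCompact : IsCompact gasket :=
  Metric.isCompact_of_isClosed_isBounded isClosed_closure
    (Metric.isBounded_iff.2 ⟨1, fun _ hx _ hy => dist_le_one_of_mem hx hy⟩)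

theorem continuous_ifs (m : Label) : Continuous (ifs m) := by
  rw [show ifs m = fun x => (1 / 2 : ℝ) • (x + corner m) from funext (ifs_eq m)]
  fun_prop

theorem ifs_mem {x : EuclideanSpace ℝ (Fin 2)} (m : Label) (hx : x ∈ gasket) :
    ifs m x ∈ gasket :=
  map_mem_closure (continuous_ifs m) hx fun _ h => Orbit.step m h

theorem iUnion_label {α : Type*} (s : Label → Set α) :
    ⋃ m, s m = s Label.a ∪ s Label.b ∪ s Label.c := by
  ext x
  simp only [Set.mem_iUnion, Set.mem_union]
  constructor
  · rintro ⟨m, h⟩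
    cases m <;> tauto
  · rintro ((h | h) | h) <;> exact ⟨_, h⟩

/-- The gasket is invariant. -/
theorem gasket_eq_iUnion : gasket = ⋃ m, ifs m '' gasket := by
  apply subset_antisymm
  · apply closure_minimal
    · intro x hx
      rw [Set.mem_iUnion]
      cases hx with
      | corner m => exact ⟨m, corner m, corner_mem m, ifs_corner m⟩
      | @step m x h => exact ⟨m, x, subset_closure h, rfl⟩
    · have h : ∀ m, IsClosed (ifs m '' gasket) := fun m =>
        (gasket_isCompact.image (continuous_ifs m)).isClosed
      rw [iUnion_label]
      exact ((h _).union (h _)).union (h _)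
  · rintro x hx
    obtain ⟨m, y, hy, rfl⟩ := Set.mem_iUnion.1 hx
    exact ifs_mem m hy

/-- The gasket is the only nonempty compact invariant set. -/
theorem eq_gasket {K : Set (EuclideanSpace ℝ (Fin 2))} (hne : K.Nonempty) (hK : IsCompact K)
    (h : K = ⋃ m, ifs m '' K) : K = gasket := by
  have hstep : ∀ m x, x ∈ K → ifs m x ∈ K := fun m x hx => by
    rw [h]; exact Set.mem_iUnion.2 ⟨m, x, hx, rfl⟩
  apply subset_antisymm
  · obtain ⟨z, hz, hmax⟩ := hK.exists_isMaxOn hne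
      (Metric.continuous_infDist_pt gasket).continuousOn
    have hz' := hz
    rw [h] at hz'
    obtain ⟨m, w, hw, rfl⟩ := Set.mem_iUnion.1 hz'
    obtain ⟨g, hg, hgd⟩ := gasket_isCompact.exists_infDist_eq_dist gasket_nonempty w
    have h1 := Metric.infDist_le_dist_of_mem (x := ifs m w) (ifs_mem m hg)
    have h2 := hmax hw
    simp only [Set.mem_ofPred_eq] at h2
    rw [dist_ifs] at h1
    intro x hx
    have h3 := hmax hx
    simp only [Set.mem_ofPred_eq] at h3
    rw [gasket_isCompact.isClosed.mem_iff_infDist_zero gasket_nonempty]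
    exact le_antisymm (by linarith) Metric.infDist_nonneg
  · apply closure_minimal _ hK.isClosed
    intro x hx
    induction hx with
    | step m _ ih => exact hstep m _ ih
    | corner m =>
      obtain ⟨z, hz, hmin⟩ := hK.exists_isMinOn hne
        (show Continuous fun y => dist y (corner m) by fun_prop).continuousOn
      have h1 := hmin (hstep m z hz)
      simp only [Set.mem_ofPred_eq] at h1
      have h2 := dist_ifs m z (corner m)
      rw [ifs_corner] at h2
      have h3 := dist_nonneg (x := z) (y := corner m)
      rwa [← dist_eq_zero.1 (show dist z (corner m) = 0 by linarith)]

/-- The gasket with the Euclidean metric as a tri-pointed metric space (lifted to an arbitrary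
universe). -/
noncomputable def gasketTri : TriMet.{u} where
  carrier := ULift.{u} gasket
  pt m := ⟨⟨corner m, corner_mem m⟩⟩
  dist_le_one x y := dist_le_one_of_mem x.down.2 y.down.2
  dist_pt _ _ h := dist_corner h

/-- A point of `gasketTri` as a point of the plane. -/
def toPlane (x : gasketTri.{u}.carrier) : EuclideanSpace ℝ (Fin 2) := (ULift.down x).1

end Sierpinski

/-! ### Maps out of the quotient, and its compactness -/

namespace TriMet

variable {X : TriMet.{u}}

/-! Each contraction takes a point to its midpoint with a corner, so the glued points have equal
images and `glueFun` is well defined. Self-similarity makes it surjective. Barycentric coordinates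
show that two distinct pieces of the gasket can meet only at the midpoint of two corners, which is
exactly what the quotient identifies, so it is injective (`eq_corner_of_ifs_eq`,
`glueFun_injective`). It does not increase distances, and a continuous bijection from a compact
space to a Hausdorff one is a homeomorphism; hence `glueIso`.

Finality is Banach's fixed point theorem. Composing with the inverse of `glueIso.inv` turns the
coalgebra equation into `transfer e f = f`. Point-preserving continuous maps to the gasket form a
closed subset of a complete function space (the gasket is compact and bounded), and `transfer e`
halves distances because `f` and `g` are compared at the same point inside one piece of the gasket
(`contractingWith_transfer`). It remains to exhibit one such map: a path in the gasket through the
three corners, composed with a real function on `X` taking suitable values at the distinguished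
points. -/

/-- By the triangle inequality, a bound on single steps adds up along any chain, and so passes to
the infimum. -/
theorem dist_le_tensorDist {Z : Type*} [PseudoMetricSpace Z] {g : X.Tensor → Z}
    (hg : ∀ m n x y, dist (g (X.tmul m x)) (g (X.tmul n y)) ≤ X.prodDist (m, x) (n, y))
    (p q : X.Tensor) : dist (g p) (g q) ≤ dist p q := by
  refine le_csInf (chain_nonempty p q) fun r hr => ?_
  induction hr with
  | nil => rw [dist_self]
  | step _ ih => exact (dist_triangle _ _ _).trans (add_le_add ih (hg _ _ _ _))

theorem compactSpace_tensor [CompactSpace X.carrier] : CompactSpace X.Tensor := by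
  refine ⟨?_⟩
  have h : (Set.univ : Set X.Tensor) = ⋃ m, Set.range (X.tmul m) := by
    refine (Set.eq_univ_of_forall fun p => ?_).symm
    obtain ⟨m, x, rfl⟩ := tensor_cases p
    exact Set.mem_iUnion.2 ⟨m, x, rfl⟩
  rw [h, Sierpinski.iUnion_label]
  exact ((isCompact_range (continuous_tmul _)).union (isCompact_range (continuous_tmul _))).union
    (isCompact_range (continuous_tmul _))

@[simp]
theorem tensorMapFun_tmul {Y : TriMet.{u}} (f : X ⟶ Y) (m : Label) (x : X.carrier) :
    tensorMapFun f (X.tmul m x) = Y.tmul m (Hom.toFun f x) := rfl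

end TriMet

/-! ### Barycentric coordinates and the overlaps of the three pieces -/

namespace Sierpinski

/-- The barycentric coordinates with respect to the three corners. -/
noncomputable def bary : Label → EuclideanSpace ℝ (Fin 2) → ℝ
  | .a, x => 2 * x 1 / √3
  | .b, x => 1 - x 0 - x 1 / √3
  | .c, x => x 0 - x 1 / √3

theorem bary_corner (m n : Label) : bary m (corner n) = if m = n then 1 else 0 := by
  have h3 : (√3 : ℝ) ≠ 0 := by positivity
  cases m <;> cases n <;> simp [bary, corner] <;> field_simp <;> norm_num

theorem bary_ifs (m n : Label) (x : EuclideanSpace ℝ (Fin 2)) :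
    bary m (ifs n x) = (bary m x + bary m (corner n)) / 2 := by
  rw [ifs_eq]
  cases m <;> simp [bary] <;> ring

theorem bary_sum (x : EuclideanSpace ℝ (Fin 2)) :
    bary Label.a x + bary Label.b x + bary Label.c x = 1 := by
  simp only [bary]; ring

theorem continuous_bary (m : Label) : Continuous (bary m) := by
  cases m <;> unfold bary <;> fun_prop

/-- The half-plane is closed, contains the corners and is stable under taking midpoints with them,
so it contains the closure of the orbit. -/
theorem bary_nonneg (m : Label) {x : EuclideanSpace ℝ (Fin 2)} (hx : x ∈ gasket) :
    0 ≤ bary m x := by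
  have hc : ∀ n, 0 ≤ bary m (corner n) := fun n => by
    rw [bary_corner]; split_ifs <;> norm_num
  refine closure_minimal (t := {y | 0 ≤ bary m y}) (fun y hy => ?_)
    (isClosed_le continuous_const (continuous_bary m)) hx
  change 0 ≤ bary m y
  induction hy with
  | corner n => exact hc n
  | step n _ ih => rw [bary_ifs]; linarith [hc n]

theorem bary_injective {x y : EuclideanSpace ℝ (Fin 2)} (h : ∀ m, bary m x = bary m y) :
    x = y := by
  have h3 : (√3 : ℝ) ≠ 0 := by positivity
  have h1 : x 1 = y 1 := by
    have := h .a
    simp only [bary] at this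
    field_simp at this
    linarith
  have h0 : x 0 = y 0 := by
    have := h .c
    simp only [bary, h1] at this
    linarith
  ext i
  fin_cases i
  exacts [h0, h1]

/-- A point of the gasket with a barycentric coordinate equal to one is a corner. -/
theorem eq_corner_of_one_le_bary {x : EuclideanSpace ℝ (Fin 2)} (hx : x ∈ gasket) {n : Label}
    (h : 1 ≤ bary n x) : x = corner n := by
  have hs := bary_sum x
  have ha := bary_nonneg .a hx
  have hb := bary_nonneg .b hx
  have hc := bary_nonneg .c hx
  refine bary_injective fun m => ?_
  rw [bary_corner]
  cases m <;> cases n <;> simp <;> linarith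

/-- The `n`-th coordinate of the common point is half that of `x`, and also at least one half since
it lies in piece `n`; so that of `x` is at least one. -/
theorem eq_corner_of_ifs_eq {x y : EuclideanSpace ℝ (Fin 2)} (hx : x ∈ gasket) (hy : y ∈ gasket)
    {m n : Label} (hmn : m ≠ n) (h : ifs m x = ifs n y) : x = corner n := by
  have h1 := congrArg (bary n) h
  rw [bary_ifs, bary_ifs, bary_corner, bary_corner, if_pos rfl, if_neg hmn.symm] at h1
  exact eq_corner_of_one_le_bary hx (by linarith [bary_nonneg n hy])

theorem ifs_injective (m : Label) : Function.Injective (ifs m) := fun x y h => by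
  have := dist_ifs m x y
  rw [h, dist_self] at this
  exact dist_eq_zero.1 (by linarith)

theorem ifs_corner_comm (m n : Label) : ifs m (corner n) = ifs n (corner m) := by
  rw [ifs_eq, ifs_eq, add_comm]

/-! ### Edges of the triangle inside the gasket -/

/-- A compact set covered by its images under the contractions lies in the gasket. -/
theorem subset_gasket {K : Set (EuclideanSpace ℝ (Fin 2))} (hK : IsCompact K)
    (h : ∀ x ∈ K, ∃ m, ∃ y ∈ K, ifs m y = x) : K ⊆ gasket := by
  intro x hx
  -- The point of `K` farthest from the gasket is the image of some `w` in `K`, so its distance is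
  -- at most half that of `w`, hence at most half the maximum. The maximum is therefore zero.
  obtain ⟨z, hz, hmax⟩ := hK.exists_isMaxOn ⟨x, hx⟩
    (Metric.continuous_infDist_pt gasket).continuousOn
  obtain ⟨m, w, hw, rfl⟩ := h z hz
  obtain ⟨g, hg, hgd⟩ := gasket_isCompact.exists_infDist_eq_dist gasket_nonempty w
  have h1 := Metric.infDist_le_dist_of_mem (x := ifs m w) (ifs_mem m hg)
  have h2 := hmax hw
  have h3 := hmax hx
  simp only [Set.mem_ofPred_eq] at h2 h3
  rw [dist_ifs] at h1
  rw [gasket_isCompact.isClosed.mem_iff_infDist_zero gasket_nonempty]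
  exact le_antisymm (by linarith) Metric.infDist_nonneg

/-- The two halves of the edge are its images under `ifs m` and `ifs n`, so `subset_gasket` applies
to the edge. -/
theorem lineMap_corner_mem (m n : Label) {t : ℝ} (ht : t ∈ Set.Icc (0 : ℝ) 1) :
    AffineMap.lineMap (corner m) (corner n) t ∈ gasket := by
  refine subset_gasket (K := AffineMap.lineMap (corner m) (corner n) '' Set.Icc (0 : ℝ) 1)
    (isCompact_Icc.image AffineMap.lineMap_continuous) ?_ ⟨t, ht, rfl⟩
  rintro _ ⟨s, ⟨h0, h1⟩, rfl⟩
  rcases le_total s (1 / 2) with hs | hs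
  · refine ⟨m, _, ⟨2 * s, ⟨by linarith, by linarith⟩, rfl⟩, ?_⟩
    rw [ifs_eq]
    simp only [AffineMap.lineMap_apply_module]
    module
  · refine ⟨n, _, ⟨2 * s - 1, ⟨by linarith, by linarith⟩, rfl⟩, ?_⟩
    rw [ifs_eq]
    simp only [AffineMap.lineMap_apply_module]
    module

/-- A path in the plane that runs from the top corner to the left one and on to the right one. -/
noncomputable def arc (t : ℝ) : EuclideanSpace ℝ (Fin 2) :=
  AffineMap.lineMap (corner .a) (corner .b) (min (2 * t) 1) +
    max (2 * t - 1) 0 • (corner .c - corner .b)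

theorem continuous_arc : Continuous arc := by
  unfold arc
  simp only [AffineMap.lineMap_apply_module]
  fun_prop

theorem arc_mem {t : ℝ} (ht : t ∈ Set.Icc (0 : ℝ) 1) : arc t ∈ gasket := by
  obtain ⟨h0, h1⟩ := ht
  unfold arc
  rcases le_total t (1 / 2) with hs | hs
  · rw [max_eq_right (by linarith), min_eq_left (by linarith), zero_smul, add_zero]
    exact lineMap_corner_mem _ _ ⟨by linarith, by linarith⟩
  · rw [max_eq_left (by linarith), min_eq_right (by linarith), AffineMap.lineMap_apply_one]
    convert lineMap_corner_mem .b .c (t := 2 * t - 1) ⟨by linarith, by linarith⟩ using 1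
    rw [AffineMap.lineMap_apply_module]
    module

/-! ### The isomorphism between the glued copies and the gasket -/

instance : CompactSpace gasketTri.{u}.carrier :=
  haveI : CompactSpace gasket := isCompact_iff_compactSpace.1 gasket_isCompact
  inferInstanceAs (CompactSpace (ULift.{u} gasket))

theorem toPlane_injective : Function.Injective toPlane.{u} := fun _ _ h =>
  ULift.down_injective (Subtype.ext h)

theorem toPlane_mem (x : gasketTri.{u}.carrier) : toPlane x ∈ gasket := x.down.2

/-- The map `m ⊗ x ↦ σ_m x`. -/
noncomputable def glueFun : gasketTri.{u}.Tensor → gasketTri.{u}.carrier :=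
  Quot.lift (fun p => ⟨⟨ifs p.1 (toPlane p.2), ifs_mem p.1 (toPlane_mem p.2)⟩⟩) (by
    rintro _ _ (_ | _ | _)
    exacts [toPlane_injective (ifs_corner_comm .b .a), toPlane_injective (ifs_corner_comm .a .c),
      toPlane_injective (ifs_corner_comm .c .b)])

@[simp]
theorem toPlane_glueFun_tmul (m : Label) (x : gasketTri.{u}.carrier) :
    toPlane (glueFun (gasketTri.tmul m x)) = ifs m (toPlane x) := rfl

theorem dist_glueFun_tmul (m : Label) (x y : gasketTri.{u}.carrier) :
    dist (glueFun (gasketTri.tmul m x)) (glueFun (gasketTri.tmul m y)) = dist x y / 2 :=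
  dist_ifs m (toPlane x) (toPlane y)

theorem continuous_glueFun : Continuous glueFun.{u} := by
  refine LipschitzWith.continuous (K := 1) (LipschitzWith.of_dist_le_mul fun p q => ?_)
  rw [NNReal.coe_one, one_mul]
  refine TriMet.dist_le_tensorDist (fun m n x y => ?_) p q
  unfold TriMet.prodDist
  split_ifs with h
  · obtain rfl : m = n := h
    exact (dist_glueFun_tmul m x y).le
  -- A step between different copies costs one, which is at least the diameter of the gasket.
  · exact gasketTri.dist_le_one _ _

theorem glueFun_injective : Function.Injective glueFun.{u} := by
  intro p q h
  obtain ⟨m, x, rfl⟩ := TriMet.tensor_cases p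
  obtain ⟨n, y, rfl⟩ := TriMet.tensor_cases q
  have h' := congrArg toPlane h
  rw [toPlane_glueFun_tmul, toPlane_glueFun_tmul] at h'
  by_cases hmn : m = n
  · subst hmn
    rw [toPlane_injective (ifs_injective m h')]
  · have hx : x = gasketTri.pt n :=
      toPlane_injective (eq_corner_of_ifs_eq (toPlane_mem x) (toPlane_mem y) hmn h')
    have hy : y = gasketTri.pt m := toPlane_injective
      (eq_corner_of_ifs_eq (toPlane_mem y) (toPlane_mem x) (Ne.symm hmn) h'.symm)
    rw [hx, hy]
    exact TriMet.tmul_glue m n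

theorem glueFun_surjective : Function.Surjective glueFun.{u} := by
  intro z
  have hz := toPlane_mem z
  rw [gasket_eq_iUnion] at hz
  obtain ⟨m, y, hy, h⟩ := Set.mem_iUnion.1 hz
  exact ⟨gasketTri.tmul m ⟨⟨y, hy⟩⟩, toPlane_injective h⟩

theorem glueFun_pt (m : Label) :
    glueFun.{u} (gasketTri.tmul m (gasketTri.pt m)) = gasketTri.pt m :=
  toPlane_injective (ifs_corner m)

/-- The map `m ⊗ x ↦ σ_m x` as a homeomorphism. -/
noncomputable def glueHomeo : gasketTri.{u}.Tensor ≃ₜ gasketTri.{u}.carrier :=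
  haveI : CompactSpace gasketTri.{u}.Tensor := TriMet.compactSpace_tensor
  Continuous.homeoOfEquivCompactToT2
    (f := Equiv.ofBijective glueFun ⟨glueFun_injective, glueFun_surjective⟩) continuous_glueFun

/-- The isomorphism `m ⊗ x ↦ σ_m x` from `M ⊗ 𝕊` to `𝕊`. -/
noncomputable def glueIso : TriMet.F.obj gasketTri.{u} ≅ gasketTri.{u} where
  hom := ⟨glueHomeo, glueHomeo.continuous, glueFun_pt⟩
  inv := ⟨glueHomeo.symm, glueHomeo.symm.continuous, fun m =>
    glueHomeo.symm_apply_eq.2 (glueFun_pt m).symm⟩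
  hom_inv_id := TriMet.Hom.ext (funext glueHomeo.symm_apply_apply)
  inv_hom_id := TriMet.Hom.ext (funext glueHomeo.apply_symm_apply)

/-! ### Finality by the contraction principle -/

section Final

open TriMet BoundedContinuousFunction

variable {X : TriMet.{u}}

variable (X) in
/-- The morphisms from `X` to the gasket as bounded continuous functions, with the supremum
metric. -/
abbrev HomSpace : Type u :=
  {f : X.carrier →ᵇ gasketTri.{u}.carrier // ∀ m, f (X.pt m) = gasketTri.pt m}

instance : CompleteSpace (HomSpace X) := by
  have h : IsClosed
      {f : X.carrier →ᵇ gasketTri.{u}.carrier | ∀ m, f (X.pt m) = gasketTri.pt m} := by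
    simp only [Set.ofPred_forall]
    exact isClosed_iInter fun m =>
      isClosed_eq (continuous_eval_const _) continuous_const
  exact h.completeSpace_coe

/-- Morphisms to the gasket are point-preserving bounded continuous functions. -/
noncomputable def homEquiv : (X ⟶ gasketTri.{u}) ≃ HomSpace X where
  toFun f := ⟨mkOfBound ⟨Hom.toFun f, Hom.continuous_toFun f⟩ 1
    fun _ _ => gasketTri.dist_le_one _ _, Hom.map_pt f⟩
  invFun f := ⟨f.1, f.1.continuous, f.2⟩
  left_inv _ := rfl
  right_inv _ := rfl

/-- The fixed point theorem needs a starting point, so one point-preserving continuous map must be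
constructed. -/
instance : Nonempty (HomSpace X) := by
  -- The values at `T`, `L`, `R` are 0, 1/2 and 1, the times at which `arc` visits the corresponding
  -- corners.
  let h : X.carrier → ℝ := fun x => dist x X.T * (1 + dist x X.L) / 2
  have hmem : ∀ x, h x ∈ Set.Icc (0 : ℝ) 1 := fun x => by
    have h1 := X.dist_le_one x X.T
    have h2 := X.dist_le_one x X.L
    have h3 : 0 ≤ dist x X.T := dist_nonneg
    have h4 : 0 ≤ dist x X.L := dist_nonneg
    exact ⟨by positivity, by simp only [h]; nlinarith⟩
  have hc : Continuous fun x => arc (h x) := continuous_arc.comp (by fun_prop)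
  refine ⟨homEquiv ⟨fun x => ⟨⟨arc (h x), arc_mem (hmem x)⟩⟩,
    continuous_uliftUp.comp (hc.subtype_mk _), fun m => toPlane_injective ?_⟩⟩
  change arc (h (X.pt m)) = corner m
  cases m
  · simp [h, arc]
  · simp [h, arc, X.dist_pt .b .a]
  · simp only [h, arc, X.dist_pt .c .a (by simp), X.dist_pt .c .b (by simp)]
    norm_num

/-- The operator whose fixed points are the coalgebra morphisms to the gasket. -/
noncomputable def transfer (e : X ⟶ F.obj X) (f : HomSpace X) : HomSpace X :=
  homEquiv (e ≫ F.map (homEquiv.symm f) ≫ glueIso.hom)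

theorem contractingWith_transfer (e : X ⟶ F.obj X) : ContractingWith (1 / 2) (transfer e) := by
  refine ⟨by norm_num, LipschitzWith.of_dist_le_mul fun f g => ?_⟩
  refine (BoundedContinuousFunction.dist_le (by positivity)).2 fun x => ?_
  obtain ⟨m, y, h⟩ := tensor_cases (X := X) (Hom.toFun e x)
  change dist (glueFun (tensorMapFun (homEquiv.symm f) (Hom.toFun e x)))
    (glueFun (tensorMapFun (homEquiv.symm g) (Hom.toFun e x))) ≤ _
  -- The label `m` and the point `y` come from `e` alone, so both images lie in piece `m`, where
  -- distances are exactly halved.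
  rw [h, tensorMapFun_tmul, tensorMapFun_tmul, dist_glueFun_tmul]
  have : dist (f.1 y) (g.1 y) ≤ dist f g := BoundedContinuousFunction.dist_coe_le_dist y
  change dist (f.1 y) (g.1 y) / 2 ≤ _
  push_cast
  linarith

theorem existsUnique_coalgebra_hom (e : X ⟶ F.obj X) :
    ∃! f : X ⟶ gasketTri.{u}, e ≫ F.map f = f ≫ glueIso.inv := by
  have key : ∀ f : X ⟶ gasketTri.{u},
      e ≫ F.map f = f ≫ glueIso.inv ↔ transfer e (homEquiv f) = homEquiv f := fun f => by
    rw [transfer, homEquiv.apply_eq_iff_eq, Equiv.symm_apply_apply, Iso.eq_comp_inv,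
      Category.assoc]
  have hc := contractingWith_transfer e
  refine ⟨homEquiv.symm (hc.fixedPoint), ?_, fun f hf => ?_⟩
  · refine (key _).2 ?_
    rw [Equiv.apply_symm_apply]
    exact hc.fixedPoint_isFixedPt
  · rw [Equiv.eq_symm_apply]
    exact hc.fixedPoint_unique ((key f).1 hf)

end Final

end Sierpinski

/-- The map `τ (m ⊗ x) = σ_m x` is an isomorphism `F 𝕊 ≅ 𝕊`, and `𝕊` with the structure map
`τ⁻¹` is a terminal object of the category of `F`-coalgebras. -/
theorem mainTheorem1 :
    ∃ τ : TriMet.F.obj Sierpinski.gasketTri.{u} ≅ Sierpinski.gasketTri.{u},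
      (∀ (m : Label) (x : Sierpinski.gasketTri.{u}.carrier),
        Sierpinski.toPlane (TriMet.Hom.toFun τ.hom (Sierpinski.gasketTri.tmul m x)) =
          Sierpinski.ifs m (Sierpinski.toPlane x)) ∧
      Nonempty (Limits.IsTerminal
        (⟨Sierpinski.gasketTri, τ.inv⟩ : Endofunctor.Coalgebra TriMet.F.{u})) := by
  refine ⟨Sierpinski.glueIso, fun _ _ => rfl, ⟨Limits.IsTerminal.ofUniqueHom (fun V =>
    ⟨(Sierpinski.existsUnique_coalgebra_hom V.str).choose,
      (Sierpinski.existsUnique_coalgebra_hom V.str).choose_spec.1⟩) fun V f => ?_⟩⟩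
  exact Endofunctor.Coalgebra.Hom.ext
    ((Sierpinski.existsUnique_coalgebra_hom V.str).choose_spec.2 f.f f.h)
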